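/- **Setting.** Let $\mathcal I=\{1,\dots,I\}$ (classes), $\mathcal J=\{1,\dots,J\}$ (server pools), and let $\mathcal E\subset\mathcal I\times\mathcal J$ be such that the bipartite graph $\mathcal G=(\mathcal I\cup\mathcal J,\mathcal E)$ is a tree. Write $\mathcal J(i)=\{j:(i,j)\in\mathcal E\}$, $\mathcal I(j)=\{i:(i,j)\in\mathcal E\}$, and $\mathbb R^{\mathcal G}$ for the set of $I\times J$ matrices that vanish off $\mathcal E$; $e$ is a vector of ones. For $n\ge1$ let $\lambda^n_i>0$, $\mu^n_{ij}>0$ ($(i,j)\in\mathcal E$) and integers $N^n_j>0$ be given such that, as $n\to\infty$, $\lambda^n_i/n\to\lambda_i>0$, $N^n_j/n\to\nu_j>0$, $\mu^n_{ij}\to\mu_{ij}>0$, and $$\hat\lambda^n_i:=\frac{\lambda^n_i-n\lambda_i}{\sqrt n}\to\hat\lambda_i,\qquad \hat\mu^n_{ij}:=\sqrt n(\mu^n_{ij}-\mu_{ij})\to\hat\mu_{ij},\qquad \hat\nu^n_j:=\sqrt n(n^{-1}N^n_j-\nu_j)\to\hat\nu_j .$$ Assume complete resource pooling: the linear program of minimizing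 $\max_j\sum_i\xi_{ij}$ over nonnegative $\xi\in\mathbb R^{\mathcal G}$ with $\sum_j\mu_{ij}\nu_j\xi_{ij}=\lambda_i$ for all $i$ has a unique solution $\xi^*$, and $\sum_i\xi^*_{ij}=1$ for all $j$ and $\xi^*_{ij}>0$ for all $(i,j)\in\mathcal E$. Put $z^*_{ij}=\xi^*_{ij}\nu_j$. Let $p\in\mathbb R^I$ be a probability vector with positive entries. **SWSS.** Let $(\vartheta_p,\kappa)\in\mathbb R\times\mathbb R^{\mathcal G}$ be the unique solution of the linear program: maximize $\vartheta$ subject to $\hat\lambda_i\le\sum_{j\in\mathcal J(i)}\mu_{ij}\kappa_{ij}-\vartheta p_i$ for all $i$ and $\sum_{i\in\mathcal I(j)}\kappa_{ij}=\hat\nu_j+\sum_{i\in\mathcal I(j)}\frac{\hat\mu_{ij}}{\mu_{ij}}z^*_{ij}$ for all $j$. For $n\ge1$ let $(\vartheta^n_p,\kappa^n)$ be the unique solution of the same program with $\hat\lambda^n,\mu^n,\hat\nu^n,\hat\mu^n$ in place of $\hat\lambda,\mu,\hat\nu,\hat\mu$ (and the same $z^*$, $p$). **Drift parameters.** Put $$h_i=\hat\lambda_i-\sum_{j\in\mathcal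 J(i)}\bigl(\mu_{ij}\xi^*_{ij}\hat\nu_j+\hat\mu_{ij}z^*_{ij}\bigr),\qquad h^n_i=\frac1{\sqrt n}\Bigl(\lambda^n_i-\sum_{j\in\mathcal J(i)}\mu^n_{ij}\xi^*_{ij}N^n_j\Bigr).$$ For $\alpha\in\mathbb R^I$, $\beta\in\mathbb R^J$ with $\langle e,\alpha\rangle=\langle e,\beta\rangle$ let $\Psi(\alpha,\beta)$ be the unique matrix in $\mathbb R^{\mathcal G}$ with row sums $\alpha$ and column sums $\beta$. Fix any pool $\hat\jmath$, and let $B_1\in\mathbb R^{I\times I}$, $B_2\in\mathbb R^{I\times J}$ be the unique matrices such that column $\hat\jmath$ of $B_2$ is zero and $$\sum_{j\in\mathcal J(i)}\mu_{ij}\Psi_{ij}(\alpha,\beta)=(B_1\alpha+B_2\beta)_i\qquad\text{for all } i \text{ and all } (\alpha,\beta) \text{ with } \langle e,\alpha\rangle=\langle e,\beta\rangle ;$$ let $B_1^n,B_2^n$ be defined likewise with $\mu^n$ in place of $\mu$. The drift of the limiting controlled diffusion, $b_i(x,(u^c,u^s))=h_i-\sum_{j\in\mathcal J(i)}\mu_{ij}\Psi_{ij}\bigl(x-\langle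 e,x\rangle^+u^c,-\langle e,x\rangle^-u^s\bigr)$, where $x\in\mathbb R^I$ and $u^c,u^s$ are probability vectors in $\mathbb R^I,\mathbb R^J$, is then $h-B_1(x-\langle e,x\rangle^+u^c)+\langle e,x\rangle^-B_2u^s$. **Theorem.** All the objects above are well defined, $B_1$ and $B_1^n$ are invertible with $\langle e,B_1^{-1}p\rangle>0$ and $\langle e,(B_1^n)^{-1}p\rangle>0$, and for every choice of $\hat\jmath$ and every $n\ge1$ $$\vartheta_p=-\frac{\langle e,B_1^{-1}h\rangle}{\langle e,B_1^{-1}p\rangle},\qquad \vartheta^n_p=-\frac{\langle e,(B_1^n)^{-1}h^n\rangle}{\langle e,(B_1^n)^{-1}p\rangle}.$$ Consequently the spare capacity $\varrho:=-\langle e,B_1^{-1}h\rangle$ satisfies $\varrho=\langle e,B_1^{-1}p\rangle\,\vartheta_p$. -/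

import Mathlib

open Filter Topology Matrix

noncomputable section

/-- The bipartite graph on the disjoint union of the classes and the server pools whose edges are
the pairs `(i, j)` in `E`. -/
def bipartiteGraph {I J : ℕ} (E : Finset (Fin I × Fin J)) : SimpleGraph (Fin I ⊕ Fin J) :=
  SimpleGraph.fromRel fun a b => ∃ i j, (i, j) ∈ E ∧ a = Sum.inl i ∧ b = Sum.inr j

/-- `poolsOf E i` is the set `𝒥(i)` of the pools that can serve class `i`. -/
def poolsOf {I J : ℕ} (E : Finset (Fin I × Fin J)) (i : Fin I) : Finset (Fin J) :=
  Finset.univ.filter fun j => (i, j) ∈ E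

/-- `classesOf E j` is the set `ℐ(j)` of the classes that can be served by pool `j`. -/
def classesOf {I J : ℕ} (E : Finset (Fin I × Fin J)) (j : Fin J) : Finset (Fin I) :=
  Finset.univ.filter fun i => (i, j) ∈ E

/-- Membership in `ℝ^𝒢`: the matrix vanishes off the edges. -/
def IsSupported {I J : ℕ} (E : Finset (Fin I × Fin J)) (ξ : Matrix (Fin I) (Fin J) ℝ) : Prop :=
  ∀ i j, (i, j) ∉ E → ξ i j = 0

/-- Feasible points of the fluid linear program. -/
structure IsFluidFeasible {I J : ℕ} (E : Finset (Fin I × Fin J)) (lam : Fin I → ℝ)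
    (μ : Matrix (Fin I) (Fin J) ℝ) (ν : Fin J → ℝ) (ξ : Matrix (Fin I) (Fin J) ℝ) : Prop where
  supported : IsSupported E ξ
  nonneg : ∀ i j, 0 ≤ ξ i j
  balance : ∀ i, ∑ j, μ i j * ν j * ξ i j = lam i

/-- Solutions of the fluid linear program: minimize `max_j ∑_i ξ i j` over the feasible points. -/
def IsFluidOptimal {I J : ℕ} (E : Finset (Fin I × Fin J)) (lam : Fin I → ℝ)
    (μ : Matrix (Fin I) (Fin J) ℝ) (ν : Fin J → ℝ) (ξ : Matrix (Fin I) (Fin J) ℝ) : Prop :=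
  IsFluidFeasible E lam μ ν ξ ∧
    ∀ ξ', IsFluidFeasible E lam μ ν ξ' → (⨆ j, ∑ i, ξ i j) ≤ ⨆ j, ∑ i, ξ' i j

/-- A sequence of multiclass multi-pool networks in the Halfin-Whitt regime, indexed by `n ≥ 1`,
on a tree and under complete resource pooling. Rates `μ i j` with `(i, j)` not an edge carry no
meaning and are never used. -/
structure NetworkSequence (I J : ℕ) where
  /-- the edges of the network graph -/
  E : Finset (Fin I × Fin J)
  tree : (bipartiteGraph E).IsTree
  /-- arrival rates of the `n`-th system -/
  lamN : ℕ → Fin I → ℝ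
  /-- service rates of the `n`-th system -/
  μN : ℕ → Matrix (Fin I) (Fin J) ℝ
  /-- numbers of servers of the `n`-th system -/
  N : ℕ → Fin J → ℕ
  lamN_pos : ∀ n, 1 ≤ n → ∀ i, 0 < lamN n i
  μN_pos : ∀ n, 1 ≤ n → ∀ i j, (i, j) ∈ E → 0 < μN n i j
  N_pos : ∀ n, 1 ≤ n → ∀ j, 0 < N n j
  /-- first-order limits -/
  lam : Fin I → ℝ
  μ : Matrix (Fin I) (Fin J) ℝ
  ν : Fin J → ℝ
  lam_pos : ∀ i, 0 < lam i
  μ_pos : ∀ i j, (i, j) ∈ E → 0 < μ i j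
  ν_pos : ∀ j, 0 < ν j
  tendsto_lam : ∀ i, Tendsto (fun n : ℕ => lamN n i / (n : ℝ)) atTop (𝓝 (lam i))
  tendsto_ν : ∀ j, Tendsto (fun n : ℕ => (N n j : ℝ) / (n : ℝ)) atTop (𝓝 (ν j))
  tendsto_μ : ∀ i j, (i, j) ∈ E → Tendsto (fun n : ℕ => μN n i j) atTop (𝓝 (μ i j))
  /-- second-order limits -/
  lamHat : Fin I → ℝ
  μHat : Matrix (Fin I) (Fin J) ℝ
  νHat : Fin J → ℝ
  tendsto_lamHat : ∀ i,
    Tendsto (fun n : ℕ => (lamN n i - (n : ℝ) * lam i) / √(n : ℝ)) atTop (𝓝 (lamHat i))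
  tendsto_μHat : ∀ i j, (i, j) ∈ E →
    Tendsto (fun n : ℕ => √(n : ℝ) * (μN n i j - μ i j)) atTop (𝓝 (μHat i j))
  tendsto_νHat : ∀ j,
    Tendsto (fun n : ℕ => √(n : ℝ) * ((n : ℝ)⁻¹ * (N n j : ℝ) - ν j)) atTop (𝓝 (νHat j))
  /-- complete resource pooling: `ξ` is the unique solution of the fluid linear program, it uses
  every pool fully, and it is positive on every edge -/
  ξ : Matrix (Fin I) (Fin J) ℝ
  ξ_optimal : IsFluidOptimal E lam μ ν ξ
  ξ_unique : ∀ ξ', IsFluidOptimal E lam μ ν ξ' → ξ' = ξ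
  ξ_full : ∀ j, ∑ i, ξ i j = 1
  ξ_pos : ∀ i j, (i, j) ∈ E → 0 < ξ i j

namespace NetworkSequence

variable {I J : ℕ} (S : NetworkSequence I J)

/-- The fluid-scale numbers `z*` of customers in service. -/
def z (i : Fin I) (j : Fin J) : ℝ := S.ξ i j * S.ν j

/-- `λ̂ⁿ` -/
def lamHatN (n : ℕ) (i : Fin I) : ℝ := (S.lamN n i - (n : ℝ) * S.lam i) / √(n : ℝ)

/-- `μ̂ⁿ` -/
def μHatN (n : ℕ) (i : Fin I) (j : Fin J) : ℝ := √(n : ℝ) * (S.μN n i j - S.μ i j)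

/-- `ν̂ⁿ` -/
def νHatN (n : ℕ) (j : Fin J) : ℝ := √(n : ℝ) * ((n : ℝ)⁻¹ * (S.N n j : ℝ) - S.ν j)

/-- `θ_j` -/
def θ (j : Fin J) : ℝ :=
  S.νHat j + ∑ i ∈ classesOf S.E j, S.μHat i j / S.μ i j * S.z i j

/-- `θⁿ_j` -/
def θN (n : ℕ) (j : Fin J) : ℝ :=
  S.νHatN n j + ∑ i ∈ classesOf S.E j, S.μHatN n i j / S.μN n i j * S.z i j

/-- The constant term `h` of the drift of the limiting diffusion. -/
def h (i : Fin I) : ℝ :=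
  S.lamHat i - ∑ j ∈ poolsOf S.E i, (S.μ i j * S.ξ i j * S.νHat j + S.μHat i j * S.z i j)

/-- The constant term `hⁿ` of the drift of the diffusion-scaled process of the `n`-th system. -/
def hN (n : ℕ) (i : Fin I) : ℝ :=
  1 / √(n : ℝ) * (S.lamN n i - ∑ j ∈ poolsOf S.E i, S.μN n i j * S.ξ i j * (S.N n j : ℝ))

end NetworkSequence

/-- Feasible points `(ϑ, κ)` of the second-order linear program. -/
structure IsStaffingFeasible {I J : ℕ} (E : Finset (Fin I × Fin J))
    (μ : Matrix (Fin I) (Fin J) ℝ) (lamHat : Fin I → ℝ) (θ : Fin J → ℝ) (p : Fin I → ℝ)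
    (ϑ : ℝ) (κ : Matrix (Fin I) (Fin J) ℝ) : Prop where
  supported : IsSupported E κ
  class_le : ∀ i, lamHat i ≤ ∑ j ∈ poolsOf E i, μ i j * κ i j - ϑ * p i
  pool_eq : ∀ j, ∑ i ∈ classesOf E j, κ i j = θ j

/-- Solutions `(ϑ, κ)` of the second-order linear program: `ϑ` is maximal. The SWSS is the
component `ϑ` of the solution. -/
def IsStaffingOptimal {I J : ℕ} (E : Finset (Fin I × Fin J))
    (μ : Matrix (Fin I) (Fin J) ℝ) (lamHat : Fin I → ℝ) (θ : Fin J → ℝ) (p : Fin I → ℝ)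
    (ϑ : ℝ) (κ : Matrix (Fin I) (Fin J) ℝ) : Prop :=
  IsStaffingFeasible E μ lamHat θ p ϑ κ ∧
    ∀ ϑ' κ', IsStaffingFeasible E μ lamHat θ p ϑ' κ' → ϑ' ≤ ϑ

/-- `ψ` is supported on the edges and has row sums `α` and column sums `β`. -/
structure IsTransport {I J : ℕ} (E : Finset (Fin I × Fin J)) (α : Fin I → ℝ) (β : Fin J → ℝ)
    (ψ : Matrix (Fin I) (Fin J) ℝ) : Prop where
  supported : IsSupported E ψ
  row_sum : ∀ i, ∑ j, ψ i j = α i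
  col_sum : ∀ j, ∑ i, ψ i j = β j

open Classical in
/-- The map `Ψ`, meaningful for `∑ α = ∑ β`: the matrix supported on the edges with row sums `α`
and column sums `β`. -/
def transport {I J : ℕ} (E : Finset (Fin I × Fin J)) (α : Fin I → ℝ) (β : Fin J → ℝ) :
    Matrix (Fin I) (Fin J) ℝ :=
  if hex : ∃ ψ, IsTransport E α β ψ then hex.choose else 0

/-- `B₁`, `B₂` are the matrices of the linear part of the drift for the service rates `μ`,
normalized so that the column of `B₂` that belongs to the pool `j₀` vanishes. -/
structure IsDriftPair {I J : ℕ} (E : Finset (Fin I × Fin J)) (μ : Matrix (Fin I) (Fin J) ℝ)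
    (j₀ : Fin J) (B₁ : Matrix (Fin I) (Fin I) ℝ) (B₂ : Matrix (Fin I) (Fin J) ℝ) : Prop where
  linear : ∀ (α : Fin I → ℝ) (β : Fin J → ℝ), ∑ i, α i = ∑ j, β j →
    ∀ i, ∑ j ∈ poolsOf E i, μ i j * transport E α β i j = (B₁ *ᵥ α + B₂ *ᵥ β) i
  column : ∀ i, B₂ i j₀ = 0

/-- The drift `b(x, (uᶜ, uˢ))` of the limiting controlled diffusion. -/
def NetworkSequence.drift {I J : ℕ} (S : NetworkSequence I J) (x uc : Fin I → ℝ)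
    (us : Fin J → ℝ) (i : Fin I) : ℝ :=
  S.h i - ∑ j ∈ poolsOf S.E i, S.μ i j *
    transport S.E (x - max (∑ k, x k) 0 • uc) (-(max (-∑ k, x k) 0 • us)) i j

/-- `⟨e, B₁⁻¹ v⟩` with `e` the vector of ones. -/
def totalInv {I : ℕ} (B₁ : Matrix (Fin I) (Fin I) ℝ) (v : Fin I → ℝ) : ℝ :=
  ∑ i, (B₁⁻¹ *ᵥ v) i

/-- The spare capacity `ϱ = -⟨e, B₁⁻¹ h⟩`. -/
def spareCapacity {I : ℕ} (B₁ : Matrix (Fin I) (Fin I) ℝ) (h : Fin I → ℝ) : ℝ :=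
  -totalInv B₁ h

end

/-!
Deleting an edge of a tree splits it in two, so the entry of `Ψ(α, β)` at an edge is the net supply
of one of the two sides. Multiplying, over all edges, one side of this cut by the inverse service
rate of the edge gives weights `y, w > 0` with `y i * μ i j = w j` on the edges. Rescaling by them
turns the constraints "rates `r` per class, totals `θ` per pool" into a transport problem, which is
uniquely solvable exactly when `⟨y, r⟩ = ⟨w, θ⟩`. Hence `(y, w)` is dual optimal for the
second-order program, at the optimum all its class constraints are tight, and `ϑ` is read off
`⟨y, λ̂ + ϑ p⟩ = ⟨w, θ⟩`. The same weights satisfy `yᵀ B₁ = w_{j₀} eᵀ`, so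
`⟨e, B₁⁻¹ v⟩ = ⟨y, v⟩ / w_{j₀}`, and `⟨y, h⟩ = ⟨y, λ̂⟩ - ⟨w, θ⟩` because `λ̂ - h` are the rates of
an explicit allocation with pool totals `θ`.
-/

section General

lemma pos_of_mem_stdSimplex {ι : Type*} [Fintype ι] {R : Type*} [Semiring R] [PartialOrder R]
    [Nontrivial R] {p : ι → R} (hp : p ∈ stdSimplex R ι) : 0 < p := by
  refine lt_of_le_of_ne hp.1 ?_
  rintro rfl
  simpa using hp.2

lemma dotProduct_lt_dotProduct_of_pos_left {ι : Type*} [Fintype ι] {R : Type*} [Semiring R]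
    [PartialOrder R] [IsStrictOrderedRing R] {u a b : ι → R} (hu : ∀ i, 0 < u i) (hab : a < b) :
    u ⬝ᵥ a < u ⬝ᵥ b := by
  obtain ⟨hle, i, hi⟩ := Pi.lt_def.1 hab
  exact Finset.sum_lt_sum (fun k _ => mul_le_mul_of_nonneg_left (hle k) (hu k).le)
    ⟨i, Finset.mem_univ i, mul_lt_mul_of_pos_left hi (hu i)⟩

lemma existsUnique_mulVec {m n R : Type*} [CommSemiring R] [Fintype n] {f : (n → R) → m → R}
    (hf : IsLinearMap R f) : ∃! M : Matrix m n R, ∀ v, M *ᵥ v = f v := by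
  classical
  refine ⟨LinearMap.toMatrix' (hf.mk' f), LinearMap.toMatrix'_mulVec _, fun M hM => ?_⟩
  exact mulVec_injective (funext fun v =>
    (hM v).trans (LinearMap.toMatrix'_mulVec (hf.mk' f) v).symm)

end General

section Graph

variable {V : Type*} {G : SimpleGraph V} {u v a b : V}

/-- The vertices that stay connected to `u` when the edge `uv` is deleted: the side of `u` in the
cut given by a bridge `uv`. -/
def bridgeSide (G : SimpleGraph V) (u v : V) : Set V :=
  {x | (G.deleteEdges {s(u, v)}).Reachable u x}

lemma left_mem_bridgeSide : u ∈ bridgeSide G u v :=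
  SimpleGraph.Reachable.refl u

lemma right_notMem_bridgeSide (hG : G.IsAcyclic) (huv : G.Adj u v) : v ∉ bridgeSide G u v :=
  SimpleGraph.isBridge_iff.1 (SimpleGraph.isAcyclic_iff_forall_adj_isBridge.1 hG huv)

lemma mem_bridgeSide_iff_of_adj (hab : G.Adj a b) (hne : s(a, b) ≠ s(u, v)) :
    a ∈ bridgeSide G u v ↔ b ∈ bridgeSide G u v := by
  have hab' : (G.deleteEdges {s(u, v)}).Adj a b := SimpleGraph.deleteEdges_adj.2 ⟨hab, hne⟩
  exact ⟨fun h => h.trans hab'.reachable, fun h => h.trans hab'.symm.reachable⟩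

variable {R : Type*} [Ring R] [DecidableEq V] {P : Submodule R (V → R)}

lemma single_sub_single_mem_of_reachable
    (hP : ∀ u v, G.Adj u v → Pi.single u 1 - Pi.single v 1 ∈ P) (huv : G.Reachable u v) :
    Pi.single u 1 - Pi.single v 1 ∈ P := by
  obtain ⟨walk⟩ := huv
  induction walk with
  | nil => simp
  | cons hadj _ ih => simpa using add_mem (hP _ _ hadj) ih

lemma mem_of_sum_eq_zero [Fintype V] (hG : G.Preconnected)
    (hP : ∀ u v, G.Adj u v → Pi.single u 1 - Pi.single v 1 ∈ P) {d : V → R}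
    (hd : ∑ v, d v = 0) : d ∈ P := by
  rcases isEmpty_or_nonempty V with _ | ⟨⟨root⟩⟩
  · simp [Subsingleton.elim d 0]
  have hdecomp : d = ∑ v, d v • (Pi.single v 1 - Pi.single root 1) := by
    simp only [smul_sub, Finset.sum_sub_distrib, ← Finset.sum_smul, hd, zero_smul, sub_zero]
    exact pi_eq_sum_univ' d
  rw [hdecomp]
  exact sum_mem fun v _ =>
    P.smul_mem _ (single_sub_single_mem_of_reachable hP (hG v root))

end Graph

section Edges

variable {I J : ℕ} {E : Finset (Fin I × Fin J)} {i i' : Fin I} {j j' : Fin J}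

lemma bipartiteGraph_adj_inl_inr : (bipartiteGraph E).Adj (Sum.inl i) (Sum.inr j) ↔ (i, j) ∈ E := by
  simp [bipartiteGraph]

lemma mem_poolsOf : j ∈ poolsOf E i ↔ (i, j) ∈ E := by
  simp [poolsOf]

lemma mem_classesOf : i ∈ classesOf E j ↔ (i, j) ∈ E := by
  simp [classesOf]

lemma sum_poolsOf {f : Fin J → ℝ} (hf : ∀ j, (i, j) ∉ E → f j = 0) :
    ∑ j ∈ poolsOf E i, f j = ∑ j, f j :=
  Finset.sum_subset (Finset.subset_univ _) fun j _ hj => hf j (mt mem_poolsOf.2 hj)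

lemma sum_classesOf {f : Fin I → ℝ} (hf : ∀ i, (i, j) ∉ E → f i = 0) :
    ∑ i ∈ classesOf E j, f i = ∑ i, f i :=
  Finset.sum_subset (Finset.subset_univ _) fun i _ hi => hf i (mt mem_classesOf.2 hi)

lemma inl_mem_bridgeSide_iff (hij : (i, j) ∈ E) (hne : (i, j) ≠ (i', j')) :
    Sum.inl i ∈ bridgeSide (bipartiteGraph E) (Sum.inl i') (Sum.inr j') ↔
      Sum.inr j ∈ bridgeSide (bipartiteGraph E) (Sum.inl i') (Sum.inr j') :=
  mem_bridgeSide_iff_of_adj (bipartiteGraph_adj_inl_inr.2 hij) (by simpa using hne)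

end Edges

section Transport

variable {I J : ℕ} {E : Finset (Fin I × Fin J)} {α α' : Fin I → ℝ} {β β' : Fin J → ℝ}
  {ψ ψ' : Matrix (Fin I) (Fin J) ℝ}

lemma isTransport_zero : IsTransport E 0 0 0 where
  supported _ _ _ := rfl
  row_sum := by simp
  col_sum := by simp

lemma IsTransport.add (h : IsTransport E α β ψ) (h' : IsTransport E α' β' ψ') :
    IsTransport E (α + α') (β + β') (ψ + ψ') where
  supported i j hij := by simp [h.supported i j hij, h'.supported i j hij]
  row_sum i := by simp [Finset.sum_add_distrib, h.row_sum, h'.row_sum]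
  col_sum j := by simp [Finset.sum_add_distrib, h.col_sum, h'.col_sum]

lemma IsTransport.smul (h : IsTransport E α β ψ) (c : ℝ) :
    IsTransport E (c • α) (c • β) (c • ψ) where
  supported i j hij := by simp [h.supported i j hij]
  row_sum i := by simp [← Finset.mul_sum, h.row_sum]
  col_sum j := by simp [← Finset.mul_sum, h.col_sum]

lemma isTransport_single {i : Fin I} {j : Fin J} (hij : (i, j) ∈ E) :
    IsTransport E (Pi.single i 1) (Pi.single j 1) (Matrix.single i j 1) where
  supported i' j' h := by
    rw [Matrix.single_apply, if_neg]
    rintro ⟨rfl, rfl⟩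
    exact h hij
  row_sum i' := by simp [Matrix.single_apply, Pi.single_apply, ite_and, eq_comm]
  col_sum j' := by simp [Matrix.single_apply, Pi.single_apply, ite_and, eq_comm]

lemma IsTransport.dotProduct_sub_dotProduct (h : IsTransport E α β ψ) (a : Fin I → ℝ)
    (b : Fin J → ℝ) : a ⬝ᵥ α - b ⬝ᵥ β = ∑ e : Fin I × Fin J, (a e.1 - b e.2) * ψ e.1 e.2 := by
  simp only [dotProduct, ← h.row_sum, ← h.col_sum, Finset.mul_sum, sub_mul,
    Finset.sum_sub_distrib, Fintype.sum_prod_type]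
  rw [Finset.sum_comm (f := fun j i => b j * ψ i j)]

lemma IsTransport.sum_eq (h : IsTransport E α β ψ) : ∑ i, α i = ∑ j, β j := by
  simpa [sub_eq_zero, one_dotProduct] using h.dotProduct_sub_dotProduct 1 1

/-- The flow through a bridge is the net supply of the side that it leaves. -/
lemma IsTransport.apply_eq (hE : (bipartiteGraph E).IsAcyclic) (h : IsTransport E α β ψ)
    {i : Fin I} {j : Fin J} (hij : (i, j) ∈ E) :
    ψ i j = (fun k => (bridgeSide (bipartiteGraph E) (.inl i) (.inr j)).indicator 1 (.inl k)) ⬝ᵥ α -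
      (fun l => (bridgeSide (bipartiteGraph E) (.inl i) (.inr j)).indicator 1 (.inr l)) ⬝ᵥ β := by
  classical
  rw [h.dotProduct_sub_dotProduct, Fintype.sum_eq_single (i, j)]
  · simp [Set.indicator_of_mem left_mem_bridgeSide,
      Set.indicator_of_notMem (right_notMem_bridgeSide hE (bipartiteGraph_adj_inl_inr.2 hij))]
  · rintro ⟨k, l⟩ hne
    by_cases hkl : (k, l) ∈ E
    · simp [Set.indicator_apply, inl_mem_bridgeSide_iff hkl hne]
    · simp [h.supported k l hkl]

lemma IsTransport.unique (hE : (bipartiteGraph E).IsAcyclic) (h : IsTransport E α β ψ)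
    (h' : IsTransport E α β ψ') : ψ = ψ' := by
  ext i j
  by_cases hij : (i, j) ∈ E
  · rw [h.apply_eq hE hij, h'.apply_eq hE hij]
  · rw [h.supported i j hij, h'.supported i j hij]

/-- The net supplies at the vertices that can be cleared along the edges in `E`; demands of the
pools count as negative supplies. -/
def transportable (E : Finset (Fin I × Fin J)) : Submodule ℝ (Fin I ⊕ Fin J → ℝ) where
  carrier := {d | ∃ ψ, IsTransport E (d ∘ Sum.inl) ((-d) ∘ Sum.inr) ψ}
  add_mem' := by
    rintro d d' ⟨ψ, h⟩ ⟨ψ', h'⟩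
    refine ⟨ψ + ψ', ?_⟩
    rw [neg_add]
    exact h.add h'
  zero_mem' := ⟨0, by rw [neg_zero]; exact isTransport_zero⟩
  smul_mem' := by
    rintro c d ⟨ψ, h⟩
    refine ⟨c • ψ, ?_⟩
    rw [← smul_neg]
    exact h.smul c

lemma single_sub_single_mem_transportable {u v : Fin I ⊕ Fin J} (huv : (bipartiteGraph E).Adj u v) :
    Pi.single u 1 - Pi.single v 1 ∈ transportable E := by
  have edge {i : Fin I} {j : Fin J} (hij : (i, j) ∈ E) :
      Pi.single (Sum.inl i) 1 - Pi.single (Sum.inr j) 1 ∈ transportable E := by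
    refine ⟨Matrix.single i j 1, ?_⟩
    convert isTransport_single hij using 1 <;> ext <;> simp [Pi.single_apply]
  rw [bipartiteGraph, SimpleGraph.fromRel_adj] at huv
  obtain ⟨-, ⟨i, j, hij, rfl, rfl⟩ | ⟨i, j, hij, rfl, rfl⟩⟩ := huv
  · exact edge hij
  · rw [← neg_sub]
    exact neg_mem (edge hij)

lemma exists_isTransport (hE : (bipartiteGraph E).Preconnected) (h : ∑ i, α i = ∑ j, β j) :
    ∃ ψ, IsTransport E α β ψ := by
  obtain ⟨ψ, hψ⟩ : Sum.elim α (-β) ∈ transportable E :=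
    mem_of_sum_eq_zero hE (fun _ _ => single_sub_single_mem_transportable) (by simp [h])
  have hβ : (-Sum.elim α (-β)) ∘ Sum.inr = β := by ext; simp
  exact ⟨ψ, by rwa [Sum.elim_comp_inl, hβ] at hψ⟩

lemma isTransport_transport (hE : (bipartiteGraph E).Preconnected) (h : ∑ i, α i = ∑ j, β j) :
    IsTransport E α β (transport E α β) := by
  have hex := exists_isTransport hE h
  rw [transport, dif_pos hex]
  exact hex.choose_spec

lemma isTransport_iff (hE : (bipartiteGraph E).IsTree) (h : ∑ i, α i = ∑ j, β j) :
    IsTransport E α β ψ ↔ ψ = transport E α β := by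
  have htransport := isTransport_transport hE.1.preconnected h
  exact ⟨fun hψ => hψ.unique hE.isAcyclic htransport, fun hψ => hψ ▸ htransport⟩

lemma isLinearMap_transport {M : Type*} [AddCommGroup M] [Module ℝ M]
    (hE : (bipartiteGraph E).IsTree) (a : M →ₗ[ℝ] Fin I → ℝ) (b : M →ₗ[ℝ] Fin J → ℝ)
    (hab : ∀ x, ∑ i, a x i = ∑ j, b x j) : IsLinearMap ℝ fun x => transport E (a x) (b x) := by
  have htransport x := isTransport_transport hE.1.preconnected (hab x)
  refine ⟨fun x y => ((isTransport_iff hE (hab _)).1 ?_).symm,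
    fun c x => ((isTransport_iff hE (hab _)).1 ?_).symm⟩
  · simpa only [map_add] using (htransport x).add (htransport y)
  · simpa only [map_smul] using (htransport x).smul c

lemma transport_eq_add (hE : (bipartiteGraph E).IsTree) (j₀ : Fin J) {α : Fin I → ℝ}
    {β : Fin J → ℝ} (h : ∑ i, α i = ∑ j, β j) :
    transport E α β = transport E α (Pi.single j₀ (∑ i, α i)) +
      transport E 0 (β - Pi.single j₀ (∑ j, β j)) := by
  refine ((isTransport_iff hE h).1 ?_).symm
  convert (isTransport_transport hE.1.preconnected (α := α) (β := Pi.single j₀ (∑ i, α i))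
    (by simp)).add (isTransport_transport hE.1.preconnected (α := 0)
      (β := β - Pi.single j₀ (∑ j, β j)) (by simp)) using 1
  · simp
  · simp [h]

end Transport

section Allocation

variable {I J : ℕ} {E : Finset (Fin I × Fin J)} {μ κ κ' : Matrix (Fin I) (Fin J) ℝ}
  {r : Fin I → ℝ} {θ : Fin J → ℝ} {y : Fin I → ℝ} {w : Fin J → ℝ}

/-- The total service rate of each class under an allocation of servers. -/
def classRate (E : Finset (Fin I × Fin J)) (μ : Matrix (Fin I) (Fin J) ℝ) :
    Matrix (Fin I) (Fin J) ℝ →ₗ[ℝ] Fin I → ℝ where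
  toFun κ i := ∑ j ∈ poolsOf E i, μ i j * κ i j
  map_add' κ κ' := by ext i; simp [mul_add, Finset.sum_add_distrib]
  map_smul' c κ := by ext i; simp [Finset.mul_sum, mul_left_comm]

lemma classRate_apply (κ : Matrix (Fin I) (Fin J) ℝ) (i : Fin I) :
    classRate E μ κ i = ∑ j ∈ poolsOf E i, μ i j * κ i j :=
  rfl

/-- `κ` is an allocation of servers along the edges that has the total `θ j` in pool `j` and, at the
service rates `μ`, serves class `i` at the total rate `r i`. The entries may be negative, since
second-order quantities are perturbations. -/
structure IsAllocation (E : Finset (Fin I × Fin J)) (μ : Matrix (Fin I) (Fin J) ℝ)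
    (r : Fin I → ℝ) (θ : Fin J → ℝ) (κ : Matrix (Fin I) (Fin J) ℝ) : Prop where
  supported : IsSupported E κ
  class_rate : classRate E μ κ = r
  pool_total : ∀ j, ∑ i ∈ classesOf E j, κ i j = θ j

/-- Positive weights of classes and pools that make the service rates depend on the pool only.
They are the dual variables of the second-order linear program. -/
structure IsBalancing (E : Finset (Fin I × Fin J)) (μ : Matrix (Fin I) (Fin J) ℝ)
    (y : Fin I → ℝ) (w : Fin J → ℝ) : Prop where
  class_pos : ∀ i, 0 < y i
  pool_pos : ∀ j, 0 < w j
  mul_eq : ∀ i j, (i, j) ∈ E → y i * μ i j = w j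

lemma exists_isBalancing (hE : (bipartiteGraph E).IsAcyclic)
    (hμ : ∀ i j, (i, j) ∈ E → 0 < μ i j) : ∃ y w, IsBalancing E μ y w := by
  classical
  let factor (e : Fin I × Fin J) (x : Fin I ⊕ Fin J) : ℝ :=
    if x ∈ bridgeSide (bipartiteGraph E) (.inl e.1) (.inr e.2) then (μ e.1 e.2)⁻¹ else 1
  have factor_pos (e) (he : e ∈ E) (x) : 0 < factor e x := by
    have := hμ e.1 e.2 he
    dsimp only [factor]
    split_ifs <;> positivity
  refine ⟨fun i => ∏ e ∈ E, factor e (.inl i), fun j => ∏ e ∈ E, factor e (.inr j),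
    fun i => Finset.prod_pos fun e he => factor_pos e he _,
    fun j => Finset.prod_pos fun e he => factor_pos e he _, fun i j hij => ?_⟩
  have hother : ∏ e ∈ E.erase (i, j), factor e (.inl i) = ∏ e ∈ E.erase (i, j), factor e (.inr j) :=
    Finset.prod_congr rfl fun e he => if_congr
      (inl_mem_bridgeSide_iff hij (Finset.ne_of_mem_erase he).symm) rfl rfl
  have hinl : factor (i, j) (.inl i) = (μ i j)⁻¹ := if_pos left_mem_bridgeSide
  have hinr : factor (i, j) (.inr j) = 1 :=
    if_neg (right_notMem_bridgeSide hE (bipartiteGraph_adj_inl_inr.2 hij))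
  rw [← Finset.mul_prod_erase E _ hij, ← Finset.mul_prod_erase E _ hij, hother, hinl, hinr,
    mul_right_comm, inv_mul_cancel₀ (hμ i j hij).ne']

lemma isAllocation_zero : IsAllocation E μ 0 0 0 where
  supported _ _ _ := rfl
  class_rate := map_zero _
  pool_total := by simp

lemma IsTransport.isAllocation {α : Fin I → ℝ} (h : IsTransport E α θ κ) :
    IsAllocation E μ (classRate E μ κ) θ κ where
  supported := h.supported
  class_rate := rfl
  pool_total j := by rw [sum_classesOf fun i hij => h.supported i j hij, h.col_sum]

namespace IsBalancing

lemma sum_mul_diagonal (hb : IsBalancing E μ y w) (hκ : IsSupported E κ) (i : Fin I) :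
    ∑ j, (κ * diagonal w) i j = y i * classRate E μ κ i := by
  rw [classRate_apply, ← sum_poolsOf (E := E) fun j hij => by simp [hκ i j hij], Finset.mul_sum]
  refine Finset.sum_congr rfl fun j hj => ?_
  rw [mul_diagonal, ← mul_assoc, hb.mul_eq i j (mem_poolsOf.1 hj), mul_comm]

lemma isAllocation_iff (hb : IsBalancing E μ y w) :
    IsAllocation E μ r θ κ ↔ IsTransport E (y * r) (w * θ) (κ * diagonal w) := by
  have hy i := (hb.class_pos i).ne'
  have hw j := (hb.pool_pos j).ne'
  have hsupp : IsSupported E (κ * diagonal w) ↔ IsSupported E κ := by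
    simp [IsSupported, mul_diagonal, hw]
  have hcol (hκ : IsSupported E κ) (j : Fin J) :
      ∑ i, (κ * diagonal w) i j = w j * ∑ i ∈ classesOf E j, κ i j := by
    simp only [mul_diagonal, ← Finset.sum_mul, mul_comm, sum_classesOf fun i hij => hκ i j hij]
  constructor
  · rintro ⟨hκ, hr, hθ⟩
    refine ⟨hsupp.2 hκ, fun i => ?_, fun j => ?_⟩
    · rw [hb.sum_mul_diagonal hκ, hr, Pi.mul_apply]
    · rw [hcol hκ, hθ, Pi.mul_apply]
  · rintro ⟨hψ, hr, hθ⟩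
    have hκ := hsupp.1 hψ
    refine ⟨hκ, funext fun i => mul_left_cancel₀ (hy i) ?_, fun j => mul_left_cancel₀ (hw j) ?_⟩
    · rw [← hb.sum_mul_diagonal hκ, hr, Pi.mul_apply]
    · rw [← hcol hκ, hθ, Pi.mul_apply]

lemma dotProduct_eq (hb : IsBalancing E μ y w) (hκ : IsAllocation E μ r θ κ) :
    y ⬝ᵥ r = w ⬝ᵥ θ :=
  (hb.isAllocation_iff.1 hκ).sum_eq

lemma exists_isAllocation (hb : IsBalancing E μ y w) (hE : (bipartiteGraph E).Preconnected)
    (h : y ⬝ᵥ r = w ⬝ᵥ θ) : ∃ κ, IsAllocation E μ r θ κ := by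
  refine ⟨transport E (y * r) (w * θ) * diagonal w⁻¹, hb.isAllocation_iff.2 ?_⟩
  have hw : diagonal w⁻¹ * diagonal w = 1 := by
    simp [diagonal_mul_diagonal, (hb.pool_pos _).ne']
  rw [Matrix.mul_assoc, hw, Matrix.mul_one]
  exact isTransport_transport hE h

lemma isAllocation_unique (hb : IsBalancing E μ y w) (hE : (bipartiteGraph E).IsAcyclic)
    (hκ : IsAllocation E μ r θ κ) (hκ' : IsAllocation E μ r θ κ') : κ = κ' := by
  have hψ : κ * diagonal w = κ' * diagonal w :=
    (hb.isAllocation_iff.1 hκ).unique hE (hb.isAllocation_iff.1 hκ')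
  ext i j
  simpa [(hb.pool_pos j).ne'] using congrFun₂ hψ i j

end IsBalancing

end Allocation

section LinearProgram

variable {I J : ℕ} {E : Finset (Fin I × Fin J)} {μ : Matrix (Fin I) (Fin J) ℝ}
  {lamHat p y : Fin I → ℝ} {θ w : Fin J → ℝ} {ϑ : ℝ} {κ : Matrix (Fin I) (Fin J) ℝ}

lemma isStaffingFeasible_iff_exists_isAllocation :
    IsStaffingFeasible E μ lamHat θ p ϑ κ ↔
      ∃ r, lamHat + ϑ • p ≤ r ∧ IsAllocation E μ r θ κ := by
  constructor
  · rintro ⟨hκ, hclass, hpool⟩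
    exact ⟨_, fun i => le_sub_iff_add_le.1 (hclass i), hκ, rfl, hpool⟩
  · rintro ⟨_, hr, hκ, rfl, hpool⟩
    exact ⟨hκ, fun i => le_sub_iff_add_le.2 (hr i), hpool⟩

lemma IsAllocation.isStaffingFeasible (hκ : IsAllocation E μ (lamHat + ϑ • p) θ κ) :
    IsStaffingFeasible E μ lamHat θ p ϑ κ :=
  isStaffingFeasible_iff_exists_isAllocation.2 ⟨_, le_rfl, hκ⟩

lemma IsBalancing.dotProduct_le (hb : IsBalancing E μ y w)
    (hκ : IsStaffingFeasible E μ lamHat θ p ϑ κ) : y ⬝ᵥ (lamHat + ϑ • p) ≤ w ⬝ᵥ θ := by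
  obtain ⟨r, hr, hκ⟩ := isStaffingFeasible_iff_exists_isAllocation.1 hκ
  exact (dotProduct_le_dotProduct_of_nonneg_left hr fun i => (hb.class_pos i).le).trans_eq
    (hb.dotProduct_eq hκ)

lemma IsBalancing.dotProduct_pos (hb : IsBalancing E μ y w) (hp : 0 < p) : 0 < y ⬝ᵥ p := by
  simpa only [dotProduct_zero] using dotProduct_lt_dotProduct_of_pos_left hb.class_pos hp

lemma IsAllocation.isStaffingOptimal (hκ : IsAllocation E μ (lamHat + ϑ • p) θ κ)
    (hb : IsBalancing E μ y w) (hp : 0 < p) : IsStaffingOptimal E μ lamHat θ p ϑ κ := by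
  refine ⟨hκ.isStaffingFeasible, fun ϑ' κ' hκ' => ?_⟩
  have hle := (hb.dotProduct_le hκ').trans_eq (hb.dotProduct_eq hκ).symm
  simp only [dotProduct_add, dotProduct_smul, smul_eq_mul, add_le_add_iff_left] at hle
  exact le_of_mul_le_mul_right hle (hb.dotProduct_pos hp)

lemma IsBalancing.exists_isAllocation_add_smul (hb : IsBalancing E μ y w)
    (hE : (bipartiteGraph E).Preconnected) (hp : 0 < p) (lamHat : Fin I → ℝ) (θ : Fin J → ℝ) :
    ∃ (ϑ : ℝ) (κ : _), IsAllocation E μ (lamHat + ϑ • p) θ κ := by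
  refine ⟨(w ⬝ᵥ θ - y ⬝ᵥ lamHat) / y ⬝ᵥ p, hb.exists_isAllocation hE ?_⟩
  rw [dotProduct_add, dotProduct_smul, smul_eq_mul, div_mul_cancel₀ _ (hb.dotProduct_pos hp).ne',
    add_sub_cancel]

/-- Complementary slackness: the dual variables are positive, so no class constraint is slack. -/
lemma IsStaffingOptimal.isAllocation (hκ : IsStaffingOptimal E μ lamHat θ p ϑ κ)
    (hb : IsBalancing E μ y w) (hE : (bipartiteGraph E).Preconnected) (hp : 0 < p) :
    IsAllocation E μ (lamHat + ϑ • p) θ κ := by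
  obtain ⟨ϑ₀, κ₀, hκ₀⟩ := hb.exists_isAllocation_add_smul hE hp lamHat θ
  have hϑ : ϑ₀ ≤ ϑ := hκ.2 ϑ₀ κ₀ hκ₀.isStaffingFeasible
  obtain ⟨r, hr, hκr⟩ := isStaffingFeasible_iff_exists_isAllocation.1 hκ.1
  have hle : y ⬝ᵥ r ≤ y ⬝ᵥ (lamHat + ϑ • p) := calc
    y ⬝ᵥ r = w ⬝ᵥ θ := hb.dotProduct_eq hκr
    _ = y ⬝ᵥ (lamHat + ϑ₀ • p) := (hb.dotProduct_eq hκ₀).symm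
    _ ≤ y ⬝ᵥ (lamHat + ϑ • p) := dotProduct_le_dotProduct_of_nonneg_left (by gcongr)
      fun i => (hb.class_pos i).le
  rcases hr.eq_or_lt with rfl | hlt
  · exact hκr
  · exact absurd hle (dotProduct_lt_dotProduct_of_pos_left hb.class_pos hlt).not_ge

lemma IsBalancing.existsUnique_isStaffingOptimal (hb : IsBalancing E μ y w)
    (hE : (bipartiteGraph E).IsTree) (hp : 0 < p) (lamHat : Fin I → ℝ) (θ : Fin J → ℝ) :
    ∃! s : ℝ × Matrix (Fin I) (Fin J) ℝ, IsStaffingOptimal E μ lamHat θ p s.1 s.2 := by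
  obtain ⟨ϑ₀, κ₀, hκ₀⟩ := hb.exists_isAllocation_add_smul hE.1.preconnected hp lamHat θ
  have hopt₀ := hκ₀.isStaffingOptimal hb hp
  refine ⟨(ϑ₀, κ₀), hopt₀, fun ⟨ϑ, κ⟩ hopt => ?_⟩
  obtain rfl : ϑ = ϑ₀ := le_antisymm (hopt₀.2 _ _ hopt.1) (hopt.2 _ _ hopt₀.1)
  have hκ := hopt.isAllocation hb hE.1.preconnected hp
  exact Prod.ext rfl (hb.isAllocation_unique hE.isAcyclic hκ hκ₀)

end LinearProgram

section Drift

variable {I J : ℕ} {E : Finset (Fin I × Fin J)} {μ : Matrix (Fin I) (Fin J) ℝ} {j₀ : Fin J}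
  {B₁ : Matrix (Fin I) (Fin I) ℝ} {B₂ : Matrix (Fin I) (Fin J) ℝ} {y : Fin I → ℝ} {w : Fin J → ℝ}

lemma IsDriftPair.classRate_transport (hB : IsDriftPair E μ j₀ B₁ B₂) {α : Fin I → ℝ}
    {β : Fin J → ℝ} (h : ∑ i, α i = ∑ j, β j) :
    classRate E μ (transport E α β) = B₁ *ᵥ α + B₂ *ᵥ β :=
  funext (hB.linear α β h)

lemma IsDriftPair.mulVec_single (hB : IsDriftPair E μ j₀ B₁ B₂) (c : ℝ) :
    B₂ *ᵥ Pi.single j₀ c = 0 := by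
  ext i
  simp [hB.column i]

lemma isDriftPair_iff (hE : (bipartiteGraph E).IsTree) :
    IsDriftPair E μ j₀ B₁ B₂ ↔
      (∀ α, B₁ *ᵥ α = classRate E μ (transport E α (Pi.single j₀ (∑ i, α i)))) ∧
      ∀ β, B₂ *ᵥ β = classRate E μ (transport E 0 (β - Pi.single j₀ (∑ j, β j))) := by
  constructor
  · refine fun hB => ⟨fun α => ?_, fun β => ?_⟩
    · rw [hB.classRate_transport (by simp), hB.mulVec_single, add_zero]
    · rw [hB.classRate_transport (by simp), mulVec_sub, hB.mulVec_single, mulVec_zero, zero_add,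
        sub_zero]
  · rintro ⟨h₁, h₂⟩
    refine ⟨fun α β h i => ?_, fun i => ?_⟩
    · rw [h₁, h₂, ← map_add, ← transport_eq_add hE j₀ h, classRate_apply]
    · have hzero : transport E 0 0 = 0 := ((isTransport_iff hE (by simp)).1 isTransport_zero).symm
      simpa [hzero] using congrFun (h₂ (Pi.single j₀ 1)) i

lemma existsUnique_isDriftPair (hE : (bipartiteGraph E).IsTree)
    (μ : Matrix (Fin I) (Fin J) ℝ) (j₀ : Fin J) :
    ∃! B : Matrix (Fin I) (Fin I) ℝ × Matrix (Fin I) (Fin J) ℝ, IsDriftPair E μ j₀ B.1 B.2 := by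
  have htotal (K : ℕ) : IsLinearMap ℝ fun v : Fin K → ℝ =>
      (Pi.single j₀ (∑ k, v k) : Fin J → ℝ) := by
    refine ⟨fun v v' => ?_, fun c v => ?_⟩
    · simp [Finset.sum_add_distrib, Pi.single_add]
    · simp [← Finset.mul_sum, ← Pi.single_smul]
  have hlin₁ := isLinearMap_transport hE LinearMap.id (htotal I).mk' (by simp)
  have hlin₂ := isLinearMap_transport hE 0 (LinearMap.id - (htotal J).mk') (by simp)
  obtain ⟨B₁, hB₁, huniq₁⟩ := existsUnique_mulVec (classRate E μ ∘ₗ hlin₁.mk').isLinear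
  obtain ⟨B₂, hB₂, huniq₂⟩ := existsUnique_mulVec (classRate E μ ∘ₗ hlin₂.mk').isLinear
  refine ⟨(B₁, B₂), (isDriftPair_iff hE).2 ⟨hB₁, hB₂⟩, fun ⟨B₁', B₂'⟩ hB' => ?_⟩
  obtain ⟨hB₁', hB₂'⟩ := (isDriftPair_iff hE).1 hB'
  exact Prod.ext (huniq₁ B₁' hB₁') (huniq₂ B₂' hB₂')

namespace IsDriftPair

lemma isAllocation (hB : IsDriftPair E μ j₀ B₁ B₂) (hE : (bipartiteGraph E).Preconnected)
    (α : Fin I → ℝ) : IsAllocation E μ (B₁ *ᵥ α) (Pi.single j₀ (∑ i, α i))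
      (transport E α (Pi.single j₀ (∑ i, α i))) := by
  have hsum : ∑ i, α i = ∑ j, (Pi.single j₀ (∑ i, α i) : Fin J → ℝ) j := by simp
  have hrate := hB.classRate_transport hsum
  rw [hB.mulVec_single, add_zero] at hrate
  exact hrate ▸ (isTransport_transport hE hsum).isAllocation

lemma dotProduct_mulVec (hB : IsDriftPair E μ j₀ B₁ B₂) (hb : IsBalancing E μ y w)
    (hE : (bipartiteGraph E).Preconnected) (α : Fin I → ℝ) :
    y ⬝ᵥ B₁ *ᵥ α = w j₀ * ∑ i, α i := by
  rw [hb.dotProduct_eq (hB.isAllocation hE α), dotProduct_single]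

lemma isUnit_det (hB : IsDriftPair E μ j₀ B₁ B₂) (hb : IsBalancing E μ y w)
    (hE : (bipartiteGraph E).IsTree) : IsUnit B₁.det := by
  rw [← Matrix.isUnit_iff_isUnit_det, ← Matrix.mulVec_injective_iff_isUnit,
    ← Matrix.coe_mulVecLin, ← LinearMap.ker_eq_bot, LinearMap.ker_eq_bot']
  intro α hα
  rw [Matrix.mulVecLin_apply] at hα
  have hsum : ∑ i, α i = 0 := by
    have hw := hB.dotProduct_mulVec hb hE.1.preconnected α
    rw [hα, dotProduct_zero] at hw
    exact (mul_eq_zero.1 hw.symm).resolve_left (hb.pool_pos j₀).ne'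
  have hψ : transport E α 0 = 0 := by
    have halloc := hB.isAllocation hE.1.preconnected α
    rw [hα, hsum, Pi.single_zero] at halloc
    exact hb.isAllocation_unique hE.isAcyclic halloc isAllocation_zero
  ext i
  have hrow := (isTransport_transport (α := α) (β := 0) hE.1.preconnected
    (by simpa using hsum)).row_sum i
  simpa [hψ] using hrow.symm

lemma mul_totalInv (hB : IsDriftPair E μ j₀ B₁ B₂) (hb : IsBalancing E μ y w)
    (hE : (bipartiteGraph E).IsTree) (v : Fin I → ℝ) : w j₀ * totalInv B₁ v = y ⬝ᵥ v := by
  rw [totalInv, ← hB.dotProduct_mulVec hb hE.1.preconnected, mulVec_mulVec,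
    mul_nonsing_inv _ (hB.isUnit_det hb hE), one_mulVec]

lemma totalInv_pos (hB : IsDriftPair E μ j₀ B₁ B₂) (hb : IsBalancing E μ y w)
    (hE : (bipartiteGraph E).IsTree) {v : Fin I → ℝ} (hv : 0 < v) : 0 < totalInv B₁ v := by
  refine pos_of_mul_pos_right ?_ (hb.pool_pos j₀).le
  exact (hb.dotProduct_pos hv).trans_eq (hB.mul_totalInv hb hE v).symm

lemma drift_eq (hB : IsDriftPair E μ j₀ B₁ B₂) (h x : Fin I → ℝ) {uc : Fin I → ℝ}
    {us : Fin J → ℝ} (huc : ∑ i, uc i = 1) (hus : ∑ j, us j = 1) :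
    (fun i => h i - ∑ j ∈ poolsOf E i, μ i j *
      transport E (x - max (∑ k, x k) 0 • uc) (-(max (-∑ k, x k) 0 • us)) i j) =
      h - B₁ *ᵥ (x - max (∑ k, x k) 0 • uc) + max (-∑ k, x k) 0 • (B₂ *ᵥ us) := by
  have hsum : ∑ i, (x - max (∑ k, x k) 0 • uc) i = ∑ j, (-(max (-∑ k, x k) 0 • us)) j := by
    simp only [Pi.sub_apply, Pi.neg_apply, Pi.smul_apply, smul_eq_mul, Finset.sum_sub_distrib,
      Finset.sum_neg_distrib, ← Finset.mul_sum, huc, hus, mul_one]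
    rcases le_total 0 (∑ k, x k) with hx | hx <;> simp [hx]
  change h - classRate E μ _ = _
  rw [hB.classRate_transport hsum, mulVec_neg, mulVec_smul]
  abel

lemma spareCapacity_eq (hB : IsDriftPair E μ j₀ B₁ B₂) (hb : IsBalancing E μ y w)
    (hE : (bipartiteGraph E).IsTree) {lamHat h p : Fin I → ℝ} (hp : 0 < p) {θ : Fin J → ℝ}
    {ϑ : ℝ} {κ₀ κ : Matrix (Fin I) (Fin J) ℝ} (h₀ : IsAllocation E μ (lamHat - h) θ κ₀)
    (hopt : IsStaffingOptimal E μ lamHat θ p ϑ κ) :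
    spareCapacity B₁ h = totalInv B₁ p * ϑ := by
  have hκ := hopt.isAllocation hb hE.1.preconnected hp
  have hdual : y ⬝ᵥ (lamHat - h) = y ⬝ᵥ (lamHat + ϑ • p) :=
    (hb.dotProduct_eq h₀).trans (hb.dotProduct_eq hκ).symm
  simp only [dotProduct_sub, dotProduct_add, dotProduct_smul, smul_eq_mul] at hdual
  refine mul_left_cancel₀ (hb.pool_pos j₀).ne' ?_
  rw [spareCapacity, mul_neg, ← mul_assoc, hB.mul_totalInv hb hE, hB.mul_totalInv hb hE]
  linarith

end IsDriftPair

end Drift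

section Network

lemma isAllocation_perturbation {I J : ℕ} {E : Finset (Fin I × Fin J)}
    {μ ξ : Matrix (Fin I) (Fin J) ℝ} (hμ : ∀ i j, (i, j) ∈ E → μ i j ≠ 0)
    (hξ : IsSupported E ξ) (hfull : ∀ j, ∑ i, ξ i j = 1) (μHat : Matrix (Fin I) (Fin J) ℝ)
    (ν νHat : Fin J → ℝ) :
    IsAllocation E μ
      (fun i => ∑ j ∈ poolsOf E i, (μ i j * ξ i j * νHat j + μHat i j * (ξ i j * ν j)))
      (fun j => νHat j + ∑ i ∈ classesOf E j, μHat i j / μ i j * (ξ i j * ν j))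
      (of fun i j => ξ i j * νHat j + μHat i j / μ i j * (ξ i j * ν j)) where
  supported i j hij := by simp [hξ i j hij]
  class_rate := by
    ext i
    rw [classRate_apply]
    refine Finset.sum_congr rfl fun j hj => ?_
    have := hμ i j (mem_poolsOf.1 hj)
    rw [of_apply]
    field_simp
  pool_total j := by
    have hpool : ∑ i ∈ classesOf E j, ξ i j = 1 :=
      (sum_classesOf fun i hij => hξ i j hij).trans (hfull j)
    simp only [of_apply]
    rw [Finset.sum_add_distrib, ← Finset.sum_mul, hpool, one_mul]

namespace NetworkSequence

variable {I J : ℕ} (S : NetworkSequence I J)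

lemma exists_isAllocation_sub_h : ∃ κ, IsAllocation S.E S.μ (S.lamHat - S.h) S.θ κ := by
  have hrate : S.lamHat - S.h = fun i =>
      ∑ j ∈ poolsOf S.E i, (S.μ i j * S.ξ i j * S.νHat j + S.μHat i j * S.z i j) :=
    funext fun i => sub_sub_cancel _ _
  rw [hrate]
  exact ⟨_, isAllocation_perturbation (fun i j hij => (S.μ_pos i j hij).ne')
    S.ξ_optimal.1.supported S.ξ_full S.μHat S.ν S.νHat⟩

lemma hN_eq {n : ℕ} (hn : n ≠ 0) (i : Fin I) :
    S.hN n i = S.lamHatN n i -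
      ∑ j ∈ poolsOf S.E i, (S.μN n i j * S.ξ i j * S.νHatN n j + S.μHatN n i j * S.z i j) := by
  have hsqrt : √(n : ℝ) ≠ 0 := by positivity
  have hinv : (n : ℝ)⁻¹ = (√(n : ℝ))⁻¹ * (√(n : ℝ))⁻¹ := by
    rw [← mul_inv, Real.mul_self_sqrt n.cast_nonneg]
  have hlam : ∑ j ∈ poolsOf S.E i, S.μ i j * S.ν j * S.ξ i j = S.lam i := by
    rw [sum_poolsOf fun j hij => by simp [S.ξ_optimal.1.supported i j hij], S.ξ_optimal.1.balance]
  have hterm (j : Fin J) :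
      S.μN n i j * S.ξ i j * S.νHatN n j + S.μHatN n i j * S.z i j =
        1 / √(n : ℝ) * (S.μN n i j * S.ξ i j * S.N n j) -
          √(n : ℝ) * (S.μ i j * S.ν j * S.ξ i j) := by
    rw [νHatN, μHatN, z, hinv]
    field_simp
    ring
  simp only [hterm, Finset.sum_sub_distrib, ← Finset.mul_sum, hlam, hN, lamHatN, sub_div,
    mul_div_right_comm, Real.div_sqrt]
  ring

lemma exists_isAllocation_sub_hN {n : ℕ} (hn : 1 ≤ n) :
    ∃ κ, IsAllocation S.E (S.μN n) (S.lamHatN n - S.hN n) (S.θN n) κ := by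
  have hrate : S.lamHatN n - S.hN n = fun i =>
      ∑ j ∈ poolsOf S.E i, (S.μN n i j * S.ξ i j * S.νHatN n j + S.μHatN n i j * S.z i j) :=
    funext fun i => by
      rw [Pi.sub_apply, S.hN_eq (Nat.one_le_iff_ne_zero.1 hn), sub_sub_cancel]
  rw [hrate]
  exact ⟨_, isAllocation_perturbation (fun i j hij => (S.μN_pos n hn i j hij).ne')
    S.ξ_optimal.1.supported S.ξ_full (S.μHatN n) S.ν (S.νHatN n)⟩

end NetworkSequence

end Network

theorem theorem4_general {I J : ℕ} {E : Finset (Fin I × Fin J)} (hE : (bipartiteGraph E).IsTree)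
    {μ : Matrix (Fin I) (Fin J) ℝ} (hμ : ∀ i j, (i, j) ∈ E → 0 < μ i j) {p : Fin I → ℝ}
    (hp : 0 < p) {lamHat h : Fin I → ℝ} {θ : Fin J → ℝ} {κ₀ : Matrix (Fin I) (Fin J) ℝ}
    (h₀ : IsAllocation E μ (lamHat - h) θ κ₀) :
    (∀ (α : Fin I → ℝ) (β : Fin J → ℝ), ∑ i, α i = ∑ j, β j →
      ∀ ψ, IsTransport E α β ψ ↔ ψ = transport E α β) ∧
    (∃! s : ℝ × Matrix (Fin I) (Fin J) ℝ, IsStaffingOptimal E μ lamHat θ p s.1 s.2) ∧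
    ∀ j₀ : Fin J,
      (∃! B : Matrix (Fin I) (Fin I) ℝ × Matrix (Fin I) (Fin J) ℝ, IsDriftPair E μ j₀ B.1 B.2) ∧
      ∀ B₁ B₂, IsDriftPair E μ j₀ B₁ B₂ →
        (∀ (x uc : Fin I → ℝ) (us : Fin J → ℝ), ∑ i, uc i = 1 → ∑ j, us j = 1 →
          (fun i => h i - ∑ j ∈ poolsOf E i, μ i j *
            transport E (x - max (∑ k, x k) 0 • uc) (-(max (-∑ k, x k) 0 • us)) i j) =
          h - B₁ *ᵥ (x - max (∑ k, x k) 0 • uc) + max (-∑ k, x k) 0 • (B₂ *ᵥ us)) ∧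
        IsUnit B₁.det ∧
        0 < totalInv B₁ p ∧
        ∀ ϑ κ, IsStaffingOptimal E μ lamHat θ p ϑ κ →
          ϑ = -(totalInv B₁ h / totalInv B₁ p) ∧
          spareCapacity B₁ h = totalInv B₁ p * ϑ := by
  obtain ⟨y, w, hb⟩ := exists_isBalancing hE.isAcyclic hμ
  refine ⟨fun α β hαβ ψ => isTransport_iff hE hαβ, hb.existsUnique_isStaffingOptimal hE hp _ _,
    fun j₀ => ⟨existsUnique_isDriftPair hE μ j₀, fun B₁ B₂ hB => ?_⟩⟩
  have hpos : 0 < totalInv B₁ p := hB.totalInv_pos hb hE hp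
  refine ⟨fun x uc us huc hus => hB.drift_eq h x huc hus, hB.isUnit_det hb hE, hpos,
    fun ϑ κ hopt => ?_⟩
  have hspare : spareCapacity B₁ h = totalInv B₁ p * ϑ := hB.spareCapacity_eq hb hE hp h₀ hopt
  refine ⟨?_, hspare⟩
  rw [← neg_div, eq_div_iff hpos.ne', mul_comm]
  exact hspare.symm

theorem theorem4 {I J : ℕ} (S : NetworkSequence I J) (p : Fin I → ℝ)
    (hp : p ∈ stdSimplex ℝ (Fin I)) (hpos : ∀ i, 0 < p i) :
    -- the map `Ψ` is well defined on `{∑ α = ∑ β}`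
    (∀ (α : Fin I → ℝ) (β : Fin J → ℝ), ∑ i, α i = ∑ j, β j →
      ∀ ψ, IsTransport S.E α β ψ ↔ ψ = transport S.E α β) ∧
    -- both linear programs have a unique solution
    (∃! s : ℝ × Matrix (Fin I) (Fin J) ℝ,
      IsStaffingOptimal S.E S.μ S.lamHat S.θ p s.1 s.2) ∧
    (∀ n, 1 ≤ n → ∃! s : ℝ × Matrix (Fin I) (Fin J) ℝ,
      IsStaffingOptimal S.E (S.μN n) (S.lamHatN n) (S.θN n) p s.1 s.2) ∧
    -- the limiting diffusion
    (∀ j₀ : Fin J,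
      (∃! B : Matrix (Fin I) (Fin I) ℝ × Matrix (Fin I) (Fin J) ℝ,
        IsDriftPair S.E S.μ j₀ B.1 B.2) ∧
      ∀ B₁ B₂, IsDriftPair S.E S.μ j₀ B₁ B₂ →
        (∀ (x : Fin I → ℝ), ∀ uc ∈ stdSimplex ℝ (Fin I), ∀ us ∈ stdSimplex ℝ (Fin J),
          S.drift x uc us = S.h - B₁ *ᵥ (x - max (∑ k, x k) 0 • uc)
            + max (-∑ k, x k) 0 • (B₂ *ᵥ us)) ∧
        IsUnit B₁.det ∧
        0 < totalInv B₁ p ∧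
        ∀ ϑ κ, IsStaffingOptimal S.E S.μ S.lamHat S.θ p ϑ κ →
          ϑ = -(totalInv B₁ S.h / totalInv B₁ p) ∧
          spareCapacity B₁ S.h = totalInv B₁ p * ϑ) ∧
    -- the `n`-th system
    (∀ n, 1 ≤ n → ∀ j₀ : Fin J,
      (∃! B : Matrix (Fin I) (Fin I) ℝ × Matrix (Fin I) (Fin J) ℝ,
        IsDriftPair S.E (S.μN n) j₀ B.1 B.2) ∧
      ∀ B₁ B₂, IsDriftPair S.E (S.μN n) j₀ B₁ B₂ →
        IsUnit B₁.det ∧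
        0 < totalInv B₁ p ∧
        ∀ ϑ κ, IsStaffingOptimal S.E (S.μN n) (S.lamHatN n) (S.θN n) p ϑ κ →
          ϑ = -(totalInv B₁ (S.hN n) / totalInv B₁ p)) := by
  have hp₀ := pos_of_mem_stdSimplex hp
  obtain ⟨_, hlim⟩ := S.exists_isAllocation_sub_h
  obtain ⟨hΨ, hϑ, hdrift⟩ := theorem4_general S.tree S.μ_pos hp₀ hlim
  refine ⟨hΨ, hϑ, fun n hn => ?_, fun j₀ => ⟨(hdrift j₀).1, fun B₁ B₂ hB => ?_⟩, fun n hn j₀ => ?_⟩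
  · obtain ⟨_, hsys⟩ := S.exists_isAllocation_sub_hN hn
    exact (theorem4_general S.tree (S.μN_pos n hn) hp₀ hsys).2.1
  · obtain ⟨hb, hrest⟩ := (hdrift j₀).2 B₁ B₂ hB
    exact ⟨fun x uc huc us hus => hb x uc us huc.2 hus.2, hrest⟩
  · obtain ⟨_, hsys⟩ := S.exists_isAllocation_sub_hN hn
    obtain ⟨hpair, hB⟩ := (theorem4_general S.tree (S.μN_pos n hn) hp₀ hsys).2.2 j₀
    refine ⟨hpair, fun B₁ B₂ hB₁₂ => ?_⟩
    obtain ⟨-, hunit, hpos₁, hopt⟩ := hB B₁ B₂ hB₁₂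
    exact ⟨hunit, hpos₁, fun ϑ κ hs => (hopt ϑ κ hs).1⟩
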